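/- Let $\eta$ be the Dedekind eta function on the upper half-plane, $T z = z+1$, $\zeta_{24}=e^{2\pi i/24}$. Let $p_1,p_2$ be primes, $N=p_1p_2$, and let $s,e,\delta$ with $s=e\delta$ be such that, up to exchanging $p_1$ and $p_2$, $(p_1,p_2,s,e,\delta)$ is a row of the following table (congruences are modulo $12$): $$\begin{array}{|c|c|c|c|c|}\hline p_1&p_2&s&e&\delta\\\hline 2&2&24&8&3\\ 2&\equiv 5&6&2&3\\ 2&\equiv 11&12&4&3\\ 3&3&6&3&2\\ 3&\equiv 7&2&1&2\\ 3&\equiv 11&6&3&2\\ \equiv 5&\equiv 5&3&1&3\\ \equiv 5&\equiv 11&3&1&3\\ \equiv 7&\equiv 7&2&1&2\\ \equiv 7&\equiv 11&2&1&2\\ \equiv 11&\equiv 11&6&1&6\\\hline\end{array}$$ or $p_1=2$, $p_2\equiv 17 \pmod{24}$ and $(s,e,\delta)=(3,1,3)$. (So $s=24/\gcd(24,(p_1-1)(p_2-1))$, except in the second row when $p_2\equiv 17\pmod{24}$, where this quotient is $3$; that row is nevertheless allowed.) Assume $N\equiv 1 \pmod \delta$. Put $$\mathfrak w(z)=\frac{\eta(z/p_1)\,\eta(z/p_2)}{\eta(z/N)\,\eta(z)},\qquad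 \phi=\zeta_{24}^{(p_1-1)(p_2-1)},\qquad \chi=\phi^{-e},\qquad \alpha_0=1,0,3 \text{ for } \delta=2,3,6 .$$ Define $B(z)=\dfrac{\eta(p_1z)\eta(p_2z)}{\eta(z)\eta(Nz)}$ and $A_\nu(z)=\mathfrak w(z+\nu)$ for $0\le\nu<N$. If $p_1\ne p_2$, let $u,v$ be integers with $up_1+vp_2=1$ and, for $0\le \nu<p_2$, let $$C_{2,\nu}(z)=\phi^{\theta_2(\nu)}\varepsilon_2\,\frac{\eta(p_1(z+\nu))\,\eta((z+\nu)/p_2)}{\eta(z+\nu)\,\eta(p_1(z+\nu)/p_2)},$$ where $\varepsilon_2=\left(\frac{p_1}{p_2}\right)$ if $p_2\ne2$ and $\varepsilon_2=1$ if $p_2=2$; $\theta_2(0)=uv(p_2+1)+u-1$ if $p_2\neq 2$ and $\theta_2(0)=(3u+2)(u-1)/2$ if $p_2=2$; and, for $\nu>0$, $\theta_2(\nu)=\mu((p_2+1)v_2+1)+\nu$ if $p_2\ne 2$ and $\theta_2(\nu)=(3p_1+2)(\nu+1)/2$ if $p_2=2$, where $\mu=\mu_\nu$ is any chosen integer with $\mu\nu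 p_1\equiv-1 \pmod{p_2}$ and $v_2=(1+p_1\mu\nu)/p_2$. The functions $C_{1,\nu}$, $0\le\nu<p_1$, and the exponents $\theta_1(\nu)$ are obtained by exchanging $p_1$ with $p_2$ and $u$ with $v$. If $p_1=p_2=p$, let, for $1\le\nu<p$, $$C_\nu(z)=\sqrt p\,\varepsilon(\nu)\,\zeta_{24}^{\theta(\nu)}\,\frac{\eta(pz)^2}{\eta(z)\,\eta(z+\nu/p)},$$ where $\mu$ is any integer with $\mu\nu\equiv-1\pmod p$, $v=(1+\mu\nu)/p$; for odd $p$, $\varepsilon(\nu)=\left(\frac{-\nu}{p}\right)$ and $\theta(\nu)=p\nu(1-\mu^2)+(-3p+2+v)\mu-3+3p$; for $p=2$, $\varepsilon(\nu)=1$ and $\theta(\nu)=0$. Define the twisted conjugates $$A'_\nu=\chi^{\alpha_0-\nu}A_\nu^e,\quad B'=B^e,\quad C'_{i,\nu}=\chi^{\theta_i(\nu)-\nu}C_{i,\nu}^e,\quad C'_\nu=\chi^{\mu}C_\nu^e .$$ Then: (a) $B'\circ T=\chi B'$. (b) There is a permutation $\sigma$ of $\{0,\dots,N-1\}$ with $A'_\nu\circ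 T=\chi A'_{\sigma(\nu)}$ for all $\nu$. (c) If $p_1\neq p_2$, then for $i=1,2$ there is a permutation $\sigma$ of $\{0,\dots,p_i-1\}$ with $C'_{i,\nu}\circ T=\chi C'_{i,\sigma(\nu)}$ for all $\nu$. (d) If $p_1=p_2=p$, then $C'_\nu\circ T=\chi C'_\nu$ for all $1\le\nu<p$. -/

import Mathlib

open scoped UpperHalfPlane MatrixGroups

noncomputable section

namespace DoubleEta

/-- `ζ₂₄ = exp(2πi/24)`. -/
def zeta24 : ℂ := Complex.exp (2 * Real.pi * Complex.I / 24)

/-- `φ = ζ₂₄ ^ ((p₁ - 1)(p₂ - 1))`. -/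
def phi (p₁ p₂ : ℕ) : ℂ := zeta24 ^ (((p₁ : ℤ) - 1) * ((p₂ : ℤ) - 1))

/-- `χ = φ ^ (-e)`. -/
def chi (p₁ p₂ e : ℕ) : ℂ := phi p₁ p₂ ^ (-(e : ℤ))

/-- The function `f ∘ T : z ↦ f (T z)`, where `T = (1 1; 0 1)`. -/
def compT (f : ℍ → ℂ) : ℍ → ℂ := fun z => f (ModularGroup.T • z)

/-- The double eta quotient `𝔴_{p₁,p₂}(z)` as an expression in a complex variable; `ModularForm.eta`
is the Dedekind eta function. -/
def wFun (p₁ p₂ : ℕ) (z : ℂ) : ℂ :=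
  (ModularForm.eta (z / p₁) * ModularForm.eta (z / p₂)) /
    (ModularForm.eta (z / (p₁ * p₂)) * ModularForm.eta z)

/-- `A_ν(z) = 𝔴_{p₁,p₂}(z + ν)`. -/
def A (p₁ p₂ ν : ℕ) (z : ℍ) : ℂ := wFun p₁ p₂ ((z : ℂ) + ν)

/-- `B(z) = η(p₁ z) η(p₂ z) / (η(z) η(p₁ p₂ z))`. -/
def B (p₁ p₂ : ℕ) (z : ℍ) : ℂ :=
  (ModularForm.eta (p₁ * (z : ℂ)) * ModularForm.eta (p₂ * (z : ℂ))) /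
    (ModularForm.eta (z : ℂ) * ModularForm.eta (p₁ * p₂ * (z : ℂ)))

/-- The exponent `θ₂(ν)` for `(p₁, p₂) = (p, q)`; here `u p + v q = 1`, and for `ν ≠ 0` the integer
`μ` satisfies `μ ν p ≡ -1 (mod q)` and `v₂ = (1 + p μ ν) / q`. The exponent `θ₁` is obtained by
exchanging `p` with `q` and `u` with `v`. All integer divisions are exact. -/
def theta (p q : ℕ) (u v μ : ℤ) (ν : ℕ) : ℤ :=
  if ν = 0 then
    if q = 2 then (3 * u + 2) * (u - 1) / 2 else u * v * (q + 1) + u - 1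
  else
    if q = 2 then (3 * p + 2) * ((ν + 1) / 2)
    else μ * ((q + 1) * ((1 + p * μ * ν) / q) + 1) + ν

/-- The sign `ε₂` for `(p₁, p₂) = (p, q)`. -/
def epsSign (p q : ℕ) [Fact q.Prime] : ℂ :=
  if q = 2 then 1 else ((legendreSym q (p : ℤ) : ℤ) : ℂ)

/-- The conjugate `C_{2,ν}` for `(p₁, p₂) = (p, q)`. The conjugate `C_{1,ν}` is obtained by
exchanging `p` with `q` and `u` with `v`. -/
def C (p q : ℕ) [Fact q.Prime] (u v μ : ℤ) (ν : ℕ) (z : ℍ) : ℂ :=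
  phi p q ^ theta p q u v μ ν * epsSign p q *
    ((ModularForm.eta (p * ((z : ℂ) + ν)) * ModularForm.eta (((z : ℂ) + ν) / q)) /
      (ModularForm.eta ((z : ℂ) + ν) * ModularForm.eta (p * ((z : ℂ) + ν) / q)))

/-- The exponent `θ(ν)` in the case `p₁ = p₂ = p`; here `1 = -μ ν + v p`, so `v = (1 + μ ν) / p`. -/
def thetaEq (p : ℕ) (μ : ℤ) (ν : ℕ) : ℤ :=
  if p = 2 then 0
  else p * ν * (1 - μ ^ 2) + (-3 * p + 2 + (1 + μ * ν) / p) * μ - 3 + 3 * p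

/-- The sign `ε(ν)` in the case `p₁ = p₂ = p`. -/
def epsSignEq (p : ℕ) [Fact p.Prime] (ν : ℕ) : ℂ :=
  if p = 2 then 1 else ((legendreSym p (-(ν : ℤ)) : ℤ) : ℂ)

/-- The conjugate `C_ν` in the case `p₁ = p₂ = p`. -/
def CEq (p : ℕ) [Fact p.Prime] (μ : ℤ) (ν : ℕ) (z : ℍ) : ℂ :=
  (Real.sqrt p : ℂ) * epsSignEq p ν * zeta24 ^ thetaEq p μ ν *
    (ModularForm.eta (p * (z : ℂ)) ^ 2 /
      (ModularForm.eta (z : ℂ) * ModularForm.eta ((z : ℂ) + ν / p)))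

/-- `α₀ = 1, 0, 3` for `δ = 2, 3, 6`; the last branch is only used for `δ = 6`. -/
def alpha0 (δ : ℕ) : ℤ := if δ = 2 then 1 else if δ = 3 then 0 else 3

/-- `A'_ν = χ ^ (α₀ - ν) A_ν ^ e`. -/
def A' (p₁ p₂ e δ ν : ℕ) (z : ℍ) : ℂ :=
  chi p₁ p₂ e ^ (alpha0 δ - ν) * A p₁ p₂ ν z ^ e

/-- `B' = B ^ e`. -/
def B' (p₁ p₂ e : ℕ) (z : ℍ) : ℂ := B p₁ p₂ z ^ e

/-- `C'_{2,ν} = χ ^ (θ₂(ν) - ν) C_{2,ν} ^ e` for `(p₁, p₂) = (p, q)`; `C'_{1,ν}` is obtained by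
exchanging `p` with `q` and `u` with `v`. -/
def C' (p q : ℕ) [Fact q.Prime] (e : ℕ) (u v μ : ℤ) (ν : ℕ) (z : ℍ) : ℂ :=
  chi p q e ^ (theta p q u v μ ν - ν) * C p q u v μ ν z ^ e

/-- `C'_ν = χ ^ μ C_ν ^ e` in the case `p₁ = p₂ = p`, where `μ ≡ -1/ν (mod p)`. -/
def CEq' (p : ℕ) [Fact p.Prime] (e : ℕ) (μ : ℤ) (ν : ℕ) (z : ℍ) : ℂ :=
  chi p p e ^ μ * CEq p μ ν z ^ e

/-- The table of parameters `(p₁, p₂, s, e, δ)`, with `δ = s / e`. In every row `s` equals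
`24 / gcd(24, (p₁ - 1)(p₂ - 1))`, except in the row `two_five` when `p₂ ≡ 17 (mod 24)`: there this
quotient is `3`, and the row `two_seventeen` has the corresponding parameters. -/
inductive TableRow : (p₁ p₂ s e δ : ℕ) → Prop
  | two_two : TableRow 2 2 24 8 3
  | two_five {p₂ : ℕ} (h : p₂ % 12 = 5) : TableRow 2 p₂ 6 2 3
  | two_seventeen {p₂ : ℕ} (h : p₂ % 24 = 17) : TableRow 2 p₂ 3 1 3
  | two_eleven {p₂ : ℕ} (h : p₂ % 12 = 11) : TableRow 2 p₂ 12 4 3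
  | three_three : TableRow 3 3 6 3 2
  | three_seven {p₂ : ℕ} (h : p₂ % 12 = 7) : TableRow 3 p₂ 2 1 2
  | three_eleven {p₂ : ℕ} (h : p₂ % 12 = 11) : TableRow 3 p₂ 6 3 2
  | five_five {p₁ p₂ : ℕ} (h₁ : p₁ % 12 = 5) (h₂ : p₂ % 12 = 5) : TableRow p₁ p₂ 3 1 3
  | five_eleven {p₁ p₂ : ℕ} (h₁ : p₁ % 12 = 5) (h₂ : p₂ % 12 = 11) : TableRow p₁ p₂ 3 1 3
  | seven_seven {p₁ p₂ : ℕ} (h₁ : p₁ % 12 = 7) (h₂ : p₂ % 12 = 7) : TableRow p₁ p₂ 2 1 2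
  | seven_eleven {p₁ p₂ : ℕ} (h₁ : p₁ % 12 = 7) (h₂ : p₂ % 12 = 11) : TableRow p₁ p₂ 2 1 2
  | eleven_eleven {p₁ p₂ : ℕ} (h₁ : p₁ % 12 = 11) (h₂ : p₂ % 12 = 11) : TableRow p₁ p₂ 6 1 6

end DoubleEta

end

namespace DoubleEta

/-! Everything follows from `η(z + n) = ζ₂₄ ^ n η(z)`. Translating by the full width (`N` for `A`,
`q` for `C`, `1` for `B`) multiplies the eta quotient by `φ ^ (±1)`, hence its `e`-th power by `χ ^
(∓1)`. The twist `χ ^ (-ν)` makes `T` act as `ν ↦ ν + 1` with factor exactly `χ`. The cycle closes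
up iff `χ ^ (N - 1) = 1` for `A'` and `χ ^ (q + 1) = 1` for `C'`; both hold because `χ ^ δ = 1`
while `δ` divides `N - 1` and `q + 1` (`chi_zpow_eq_one`, `TableRow.dvd_add_one`,
`exists_perm_of_cyclic`). For `p₁ = p₂`, each `C_ν ^ e` is itself an eigenfunction of `T`, and its
eigenvalue is `χ` because `24 ∣ (p² - 1) e`. -/

lemma zeta24_ne_zero : zeta24 ≠ 0 := Complex.exp_ne_zero _

lemma phi_ne_zero (p q : ℕ) : phi p q ≠ 0 := zpow_ne_zero _ zeta24_ne_zero

lemma chi_ne_zero (p q e : ℕ) : chi p q e ≠ 0 := zpow_ne_zero _ (phi_ne_zero p q)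

lemma zeta24_pow : zeta24 ^ 24 = 1 := by
  rw [zeta24, ← Complex.exp_nat_mul]
  convert Complex.exp_two_pi_mul_I using 2
  push_cast
  ring

lemma zeta24_zpow_eq_one {n : ℤ} (h : (24 : ℤ) ∣ n) : zeta24 ^ n = 1 := by
  obtain ⟨k, rfl⟩ := h
  rw [zpow_mul, zpow_ofNat, zeta24_pow, one_zpow]

lemma zeta24_zpow_congr {m n : ℤ} (h : (24 : ℤ) ∣ m - n) : zeta24 ^ m = zeta24 ^ n := by
  rw [← sub_add_cancel m n, zpow_add₀ zeta24_ne_zero, zeta24_zpow_eq_one h, one_mul]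

lemma phi_comm (p q : ℕ) : phi p q = phi q p := by
  rw [phi, phi, mul_comm]

lemma chi_comm (p q e : ℕ) : chi p q e = chi q p e := by
  rw [chi, chi, phi_comm]

lemma phi_pow_eq (p q e : ℕ) : phi p q ^ e = (chi p q e)⁻¹ := by
  rw [chi, zpow_neg, inv_inv, zpow_natCast]

lemma chi_eq_zpow (p q e : ℕ) :
    chi p q e = zeta24 ^ (((p : ℤ) - 1) * ((q : ℤ) - 1) * -(e : ℤ)) := by
  rw [chi, phi, ← zpow_mul]

/-! ### Translation of eta by integers -/

lemma eta_add_intCast (z : ℂ) (n : ℤ) :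
    ModularForm.eta (z + n) = zeta24 ^ n * ModularForm.eta z := by
  have h₁ : Function.Periodic.qParam 1 (z + n) = Function.Periodic.qParam 1 z := by
    simp only [Function.Periodic.qParam, Complex.ofReal_one, div_one]
    rw [mul_add, Complex.exp_add, mul_comm _ (n : ℂ), Complex.exp_int_mul_two_pi_mul_I, mul_one]
  have h₂ : Function.Periodic.qParam 24 (z + n) =
      zeta24 ^ n * Function.Periodic.qParam 24 z := by
    rw [zeta24, ← Complex.exp_int_mul, Function.Periodic.qParam, Function.Periodic.qParam,
      ← Complex.exp_add]
    congr 1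
    push_cast
    ring
  simp only [ModularForm.eta, ModularForm.eta_q, h₁, h₂, mul_assoc]

lemma eta_quotient_add_intCast (x y w t : ℂ) (a b c d : ℤ) :
    ModularForm.eta (x + a) * ModularForm.eta (y + b) /
        (ModularForm.eta (w + c) * ModularForm.eta (t + d)) =
      zeta24 ^ (a + b - c - d) * (ModularForm.eta x * ModularForm.eta y /
        (ModularForm.eta w * ModularForm.eta t)) := by
  simp only [eta_add_intCast]
  rw [zpow_sub₀ zeta24_ne_zero, zpow_sub₀ zeta24_ne_zero, zpow_add₀ zeta24_ne_zero]
  simp only [div_eq_mul_inv, mul_inv]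
  ring

lemma coe_T_smul (z : ℍ) : ((ModularGroup.T • z : ℍ) : ℂ) = z + 1 := by
  rw [UpperHalfPlane.modular_T_smul, UpperHalfPlane.coe_vadd]
  push_cast
  ring

/-! ### Arithmetic of the table -/

lemma TableRow.dvd {p q s e δ : ℕ} (h : TableRow p q s e δ) :
    (24 : ℤ) ∣ ((p : ℤ) - 1) * ((q : ℤ) - 1) * e * δ := by
  cases h with
  | two_two => norm_num
  | two_five h => push_cast; omega
  | two_seventeen h => push_cast; omega
  | two_eleven h => push_cast; omega
  | three_three => norm_num
  | three_seven h => push_cast; omega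
  | three_eleven h => push_cast; omega
  | five_five h₁ h₂ =>
    -- With both factors variable the product is nonlinear; once its divisibility by a constant is
    -- known, `omega` can treat it as an atom.
    have := mul_dvd_mul (show (4 : ℤ) ∣ (p : ℤ) - 1 by omega) (show (4 : ℤ) ∣ (q : ℤ) - 1 by omega)
    push_cast; omega
  | five_eleven h₁ h₂ =>
    have := mul_dvd_mul (show (4 : ℤ) ∣ (p : ℤ) - 1 by omega) (show (2 : ℤ) ∣ (q : ℤ) - 1 by omega)
    push_cast; omega
  | seven_seven h₁ h₂ =>
    have := mul_dvd_mul (show (6 : ℤ) ∣ (p : ℤ) - 1 by omega) (show (6 : ℤ) ∣ (q : ℤ) - 1 by omega)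
    push_cast; omega
  | seven_eleven h₁ h₂ =>
    have := mul_dvd_mul (show (6 : ℤ) ∣ (p : ℤ) - 1 by omega) (show (2 : ℤ) ∣ (q : ℤ) - 1 by omega)
    push_cast; omega
  | eleven_eleven h₁ h₂ =>
    have := mul_dvd_mul (show (2 : ℤ) ∣ (p : ℤ) - 1 by omega) (show (2 : ℤ) ∣ (q : ℤ) - 1 by omega)
    push_cast; omega

/-- In each row both primes are `-1` modulo `δ`: they are `2` mod `3`, odd, or `11` mod `12` for `δ
= 3, 2, 6`. -/
lemma TableRow.dvd_add_one {p q s e δ : ℕ} (h : TableRow p q s e δ) (hN : p * q ≡ 1 [MOD δ]) :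
    δ ∣ p + 1 ∧ δ ∣ q + 1 := by
  cases h <;> simp only [Nat.ModEq] at hN <;> omega

lemma TableRow.dvd_of_eq {p s e δ : ℕ} (h : TableRow p p s e δ) :
    (24 : ℤ) ∣ ((p : ℤ) - 1) * ((p : ℤ) + 1) * e := by
  generalize hq : p = q at h
  have key {a b : ℤ} (hc : (24 : ℤ) ∣ a * b) (ha : a ∣ (q : ℤ) - 1) (hb : b ∣ (q : ℤ) + 1) :
      (24 : ℤ) ∣ ((q : ℤ) - 1) * ((q : ℤ) + 1) * e :=
    (hc.trans (mul_dvd_mul ha hb)).mul_right _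
  cases h with
  | two_two => norm_num
  | three_three => norm_num
  | five_five h₁ h₂ => exact key (a := 4) (b := 6) (by norm_num) (by omega) (by omega)
  | seven_seven h₁ h₂ => exact key (a := 6) (b := 4) (by norm_num) (by omega) (by omega)
  | eleven_eleven h₁ h₂ => exact key (a := 2) (b := 12) (by norm_num) (by omega) (by omega)
  | _ => omega

lemma chi_zpow_eq_one {p q s e δ : ℕ} (h : TableRow p q s e δ ∨ TableRow q p s e δ) {n : ℤ}
    (hn : (δ : ℤ) ∣ n) : chi p q e ^ n = 1 := by
  have hd : (24 : ℤ) ∣ ((p : ℤ) - 1) * ((q : ℤ) - 1) * e * δ := by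
    rcases h with h | h
    · exact h.dvd
    · rw [mul_comm ((p : ℤ) - 1)]
      exact h.dvd
  obtain ⟨k, rfl⟩ := hn
  rw [chi_eq_zpow, ← zpow_mul]
  refine zeta24_zpow_eq_one (hd.trans ⟨-k, ?_⟩)
  ring

/-! ### The conjugates -/

lemma B_add_one (p q : ℕ) (z : ℍ) :
    B p q (ModularGroup.T • z) = (phi p q)⁻¹ * B p q z := by
  have h := eta_quotient_add_intCast (p * (z : ℂ)) (q * (z : ℂ)) z (p * q * (z : ℂ))
    p q 1 (p * q)
  rw [B, B, coe_T_smul, phi, ← zpow_neg]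
  convert h using 2 <;> push_cast <;> ring_nf

lemma wFun_add_mul {p q : ℕ} (hp : p ≠ 0) (hq : q ≠ 0) (z : ℂ) :
    wFun p q (z + (p * q : ℕ)) = (phi p q)⁻¹ * wFun p q z := by
  have hp' : (p : ℂ) ≠ 0 := by exact_mod_cast hp
  have hq' : (q : ℂ) ≠ 0 := by exact_mod_cast hq
  have h := eta_quotient_add_intCast (z / p) (z / q) (z / (p * q)) z q p 1 (p * q)
  rw [wFun, wFun, phi, ← zpow_neg]
  have e₁ : (z + (p * q : ℕ)) / p = z / p + ((q : ℤ) : ℂ) := by push_cast; field_simp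
  have e₂ : (z + (p * q : ℕ)) / q = z / q + ((p : ℤ) : ℂ) := by push_cast; field_simp
  have e₃ : (z + (p * q : ℕ)) / (p * q) = z / (p * q) + ((1 : ℤ) : ℂ) := by push_cast; field_simp
  have e₄ : z + (p * q : ℕ) = z + ((p * q : ℤ) : ℂ) := by push_cast; rfl
  rw [e₁, e₂, e₃, e₄, h]
  congr 2
  ring

/-- The eta quotient underlying the conjugates `C_{2,ν}`. -/
noncomputable def cFun (p q : ℕ) (z : ℂ) : ℂ :=
  ModularForm.eta (p * z) * ModularForm.eta (z / q) /
    (ModularForm.eta z * ModularForm.eta (p * z / q))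

lemma cFun_add {p q : ℕ} (hq : q ≠ 0) (z : ℂ) :
    cFun p q (z + q) = phi p q * cFun p q z := by
  have hq' : (q : ℂ) ≠ 0 := by exact_mod_cast hq
  have h := eta_quotient_add_intCast (p * z) (z / q) z (p * z / q) (p * q) 1 q p
  rw [cFun, cFun, phi]
  have e₁ : (p : ℂ) * (z + q) = p * z + ((p * q : ℤ) : ℂ) := by push_cast; ring
  have e₂ : (z + q) / q = z / q + ((1 : ℤ) : ℂ) := by push_cast; field_simp
  have e₃ : z + (q : ℂ) = z + ((q : ℤ) : ℂ) := by push_cast; rfl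
  have e₄ : (p : ℂ) * (z + q) / q = p * z / q + ((p : ℤ) : ℂ) := by push_cast; field_simp
  rw [e₄, e₁, e₂, e₃, h]
  congr 2
  ring

/-- Since `φ ^ e = χ⁻¹`, the twist `χ ^ θ` cancels the root of unity in `C ^ e`, so no dependence on
`u`, `v`, `μ` remains. -/
lemma C'_eq (p q : ℕ) [Fact q.Prime] (e : ℕ) (u v μ : ℤ) (ν : ℕ) (z : ℍ) :
    C' p q e u v μ ν z = chi p q e ^ (-(ν : ℤ)) * epsSign p q ^ e * cFun p q (z + ν) ^ e := by
  have h : (phi p q ^ theta p q u v μ ν) ^ e = chi p q e ^ (-theta p q u v μ ν) := by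
    rw [← zpow_natCast, zpow_comm, zpow_natCast, phi_pow_eq, inv_zpow, zpow_neg]
  rw [C', C, mul_pow, mul_pow, h, cFun, ← mul_assoc, ← mul_assoc, ← zpow_add₀ (chi_ne_zero p q e)]
  congr 3
  ring

lemma exists_perm_of_cyclic {n : ℕ} (hn : 0 < n) (F : ℕ → ℍ → ℂ) (c : ℂ)
    (h : ∀ ν, compT (F ν) = c • F (ν + 1)) (h₀ : F n = F 0) :
    ∃ σ : Equiv.Perm (Fin n), ∀ ν : Fin n, compT (F ν) = c • F (σ ν) := by
  obtain ⟨m, rfl⟩ : ∃ m, n = m + 1 := ⟨n - 1, by omega⟩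
  refine ⟨finRotate (m + 1), fun ν => ?_⟩
  rw [h]
  -- Only the last index wraps around, and there `h₀` identifies `F n` with `F 0`.
  rcases eq_or_ne ν (Fin.last m) with rfl | hν
  · rw [finRotate_last, Fin.val_last, h₀, Fin.val_zero]
  · rw [coe_finRotate_of_ne_last hν]

lemma compT_B' (p q e : ℕ) : compT (B' p q e) = chi p q e • B' p q e := by
  funext z
  rw [compT, Pi.smul_apply, smul_eq_mul, B', B', B_add_one, mul_pow, inv_pow, phi_pow_eq, inv_inv]

lemma exists_perm_A' {p q s e δ : ℕ} (hp : p ≠ 0) (hq : q ≠ 0)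
    (h : TableRow p q s e δ ∨ TableRow q p s e δ) (hN : p * q ≡ 1 [MOD δ]) :
    ∃ σ : Equiv.Perm (Fin (p * q)), ∀ ν : Fin (p * q),
      compT (A' p q e δ ν) = chi p q e • A' p q e δ (σ ν) := by
  have hχ := chi_ne_zero p q e
  refine exists_perm_of_cyclic (by positivity) (A' p q e δ) _ (fun ν => ?_) ?_
  · funext z
    rw [compT, Pi.smul_apply, smul_eq_mul, A', A', A, A, coe_T_smul, ← mul_assoc,
      ← zpow_one_add₀ hχ]
    push_cast
    congr 2
    · ring
    · congr 1
      ring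
  · funext z
    -- Going once around costs `χ ^ (-N)` from the twist and gains `χ` from the quotient; `α₀` is a
    -- common factor.
    have h₁ : chi p q e ^ ((p * q : ℕ) - 1 : ℤ) = 1 :=
      chi_zpow_eq_one h (by simpa using hN.symm.dvd)
    rw [A', A', A, A, wFun_add_mul hp hq, mul_pow, inv_pow, phi_pow_eq, inv_inv, ← mul_assoc,
      ← zpow_add_one₀ hχ, ← mul_one (chi p q e ^ _), ← h₁, ← zpow_add₀ hχ]
    push_cast
    rw [add_zero]
    congr 2
    ring

lemma exists_perm_C' {p q e : ℕ} [Fact q.Prime] (h : chi p q e ^ ((q : ℤ) + 1) = 1) (u v : ℤ)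
    (μ : ℕ → ℤ) :
    ∃ σ : Equiv.Perm (Fin q), ∀ ν : Fin q,
      compT (C' p q e u v (μ ν) ν) = chi p q e • C' p q e u v (μ (σ ν)) (σ ν) := by
  have hχ := chi_ne_zero p q e
  have hq : q.Prime := Fact.out
  refine exists_perm_of_cyclic hq.pos (fun ν => C' p q e u v (μ ν) ν) _ (fun ν => ?_) ?_
  · funext z
    rw [compT, Pi.smul_apply, smul_eq_mul, C'_eq, C'_eq, coe_T_smul, ← mul_assoc, ← mul_assoc,
      ← zpow_one_add₀ hχ]
    push_cast
    congr 3
    · ring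
    · ring
  · funext z
    rw [C'_eq, C'_eq, cFun_add hq.ne_zero, mul_pow, phi_pow_eq]
    -- Here the quotient contributes `χ⁻¹` rather than `χ`, hence the condition on `q + 1`.
    have h₁ : chi p q e ^ (-(q : ℤ)) * (chi p q e)⁻¹ = 1 := by
      rw [← zpow_sub_one₀ hχ, ← neg_add', zpow_neg, h, inv_one]
    push_cast
    rw [neg_zero, zpow_zero, add_zero, ← h₁]
    ring

lemma CEq_add_one (p : ℕ) [Fact p.Prime] (μ : ℤ) (ν : ℕ) (z : ℍ) :
    CEq p μ ν (ModularGroup.T • z) = zeta24 ^ (2 * ((p : ℤ) - 1)) * CEq p μ ν z := by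
  have h := eta_quotient_add_intCast (p * (z : ℂ)) (p * z) z (z + ν / p) p p 1 1
  have e₁ : (p : ℂ) * (z + 1) = p * z + ((p : ℤ) : ℂ) := by push_cast; ring
  have e₂ : (z : ℂ) + 1 + ν / p = z + ν / p + ((1 : ℤ) : ℂ) := by push_cast; ring
  have e₃ : (z : ℂ) + 1 = z + ((1 : ℤ) : ℂ) := by push_cast; rfl
  rw [CEq, CEq, coe_T_smul, e₁, e₂, e₃, pow_two, pow_two, h]
  rw [show (p : ℤ) + p - 1 - 1 = 2 * (p - 1) by ring]
  ring

lemma compT_CEq' {p s e δ : ℕ} [Fact p.Prime] (h : TableRow p p s e δ) (μ : ℤ) (ν : ℕ) :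
    compT (CEq' p e μ ν) = chi p p e • CEq' p e μ ν := by
  funext z
  have h₁ : (zeta24 ^ (2 * ((p : ℤ) - 1))) ^ e = chi p p e := by
    rw [← zpow_natCast, ← zpow_mul, chi_eq_zpow]
    -- The exponents differ by `2(p - 1)e + (p - 1)²e = (p - 1)(p + 1)e`.
    refine zeta24_zpow_congr (h.dvd_of_eq.trans (dvd_of_eq ?_))
    ring
  rw [compT, Pi.smul_apply, smul_eq_mul, CEq', CEq', CEq_add_one, mul_pow, h₁]
  ring

end DoubleEta

theorem mainTheorem7 (p₁ p₂ : ℕ) [Fact p₁.Prime] [Fact p₂.Prime] (s e δ : ℕ)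
    (hrow : DoubleEta.TableRow p₁ p₂ s e δ ∨ DoubleEta.TableRow p₂ p₁ s e δ)
    (hN : p₁ * p₂ ≡ 1 [MOD δ]) :
    DoubleEta.compT (DoubleEta.B' p₁ p₂ e) =
        DoubleEta.chi p₁ p₂ e • DoubleEta.B' p₁ p₂ e ∧
    (∃ σ : Equiv.Perm (Fin (p₁ * p₂)), ∀ ν : Fin (p₁ * p₂),
      DoubleEta.compT (DoubleEta.A' p₁ p₂ e δ ν) =
        DoubleEta.chi p₁ p₂ e • DoubleEta.A' p₁ p₂ e δ (σ ν)) ∧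
    (p₁ ≠ p₂ → ∀ u v : ℤ, u * p₁ + v * p₂ = 1 →
      (∀ μ : ℕ → ℤ, (∀ ν : ℕ, 0 < ν → ν < p₁ → (p₁ : ℤ) ∣ 1 + p₂ * μ ν * ν) →
        ∃ σ : Equiv.Perm (Fin p₁), ∀ ν : Fin p₁,
          DoubleEta.compT (DoubleEta.C' p₂ p₁ e v u (μ ν) ν) =
            DoubleEta.chi p₁ p₂ e • DoubleEta.C' p₂ p₁ e v u (μ (σ ν)) (σ ν)) ∧
      (∀ μ : ℕ → ℤ, (∀ ν : ℕ, 0 < ν → ν < p₂ → (p₂ : ℤ) ∣ 1 + p₁ * μ ν * ν) →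
        ∃ σ : Equiv.Perm (Fin p₂), ∀ ν : Fin p₂,
          DoubleEta.compT (DoubleEta.C' p₁ p₂ e u v (μ ν) ν) =
            DoubleEta.chi p₁ p₂ e • DoubleEta.C' p₁ p₂ e u v (μ (σ ν)) (σ ν))) ∧
    (p₁ = p₂ → ∀ (ν : ℕ) (μ : ℤ), 0 < ν → ν < p₁ → (p₁ : ℤ) ∣ 1 + μ * ν →
      DoubleEta.compT (DoubleEta.CEq' p₁ e μ ν) =
        DoubleEta.chi p₁ p₂ e • DoubleEta.CEq' p₁ e μ ν) := by
  obtain ⟨hd₁, hd₂⟩ : δ ∣ p₁ + 1 ∧ δ ∣ p₂ + 1 := by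
    rcases hrow with h | h
    · exact h.dvd_add_one hN
    · exact (h.dvd_add_one (by rwa [mul_comm])).symm
  have hp₁ : p₁.Prime := Fact.out
  have hp₂ : p₂.Prime := Fact.out
  refine ⟨DoubleEta.compT_B' p₁ p₂ e,
    DoubleEta.exists_perm_A' hp₁.ne_zero hp₂.ne_zero hrow hN,
    fun _ u v _ => ⟨fun μ _ => ?_, fun μ _ => ?_⟩, ?_⟩
  · rw [DoubleEta.chi_comm]
    exact DoubleEta.exists_perm_C'
      (DoubleEta.chi_zpow_eq_one hrow.symm (by exact_mod_cast hd₁)) v u μ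
  · exact DoubleEta.exists_perm_C'
      (DoubleEta.chi_zpow_eq_one hrow (by exact_mod_cast hd₂)) u v μ
  · rintro rfl ν μ _ _ _
    exact DoubleEta.compT_CEq' (hrow.elim id id) μ ν
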